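/- Let $\mathbb{F}_q$ be a finite field, let $S_1,\dots,S_m\subseteq\mathbb{F}_q$ with $s_i=\#S_i$, and choose integers $0\le v_i<j_i<s_i$ for $i=1,\dots,m$. Put $S=S_1\times\cdots\times S_m$, $n=\#S=s_1\cdots s_m$, and $$\Delta=\{X_1^{i_1}\cdots X_m^{i_m}\mid 0\le i_t<s_t\},\qquad L_1=\{X_1^{i_1}\cdots X_m^{i_m}\mid 0\le i_t\le j_t\},$$ $$\Box=\{X_1^{i_1}\cdots X_m^{i_m}\mid v_t\le i_t\le j_t\},\qquad L_2=L_1\setminus\Box .$$ For $L\subseteq\Delta$ let $C(L)\subseteq\mathbb{F}_q^{S}$ be the span of the evaluation vectors $(M(\alpha))_{\alpha\in S}$, $M\in L$. For $K\subseteq\Delta$ let $D(K)$ be the number of monomials in $\Delta$ that are divisible by some element of $K$. Let $\prec$ be the lexicographic ordering with $X_m\prec\cdots\prec X_1$ and let $\Diamond=\{M\in L_1\mid X_1^{v_1}\cdots X_m^{v_m}\preceq M\}$. Assume that the scheme is considerate: for every $i=1,\dots,\#\Box$, the minimum of $D(K)$ over all $K\subseteq\Diamond$ with $\#K=i$ is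 attained by some $K'\subseteq\Box$. Consider a linear ramp secret sharing scheme defined from $C_2=C(L_2)\subseteq C_1=C(L_1)$: choose a basis $b_1,\dots,b_{k_2}$ of $C_2$ and extend it by $b_{k_2+1},\dots,b_{k_2+\ell}$ to a basis of $C_1$. A secret $(x_1,\dots,x_\ell)\in\mathbb{F}_q^\ell$ is encoded as $c=\sum_{i\le k_2}a_ib_i+\sum_{i\le\ell}x_ib_{k_2+i}$ with $a\in\mathbb{F}_q^{k_2}$ random, and participant $\alpha\in S$ receives the share $c_\alpha$. For a set $A\subseteq S$ of participants the secrets in accordance with their shares form a coset $p+V\subseteq\mathbb{F}_q^\ell$, and $A$ is said to recover $u$ $q$-bits of information if $\ell-\dim V\ge u$. Let $r_u$ be the smallest number such that every set of $r_u$ participants recovers $u$ $q$-bits; call $A$ non-$u$-qualifying if it does not recover $u$ $q$-bits, and maximum non-$u$-qualifying if it has the largest size among the non-$u$-qualifying sets. Then $\ell=\#\Box$, and $$r_1=\prod_{i=1}^m s_i-\prod_{i=1}^m(s_i-v_i)+1,\qquad r_\ell=\prod_{i=1}^m s_i-\prod_{i=1}^m(s_i-j_i)+1 .$$ For all $T^{(i)}_{\max}\subseteq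 S_i$ with $\#T^{(i)}_{\max}=s_i-v_i$ ($i=1,\dots,m$), the set $S\setminus(T^{(1)}_{\max}\times\cdots\times T^{(m)}_{\max})$ is maximum non-$1$-qualifying. A set $A\subseteq S$ is maximum non-$\ell$-qualifying if and only if $A=S\setminus(T^{(1)}_{\min}\times\cdots\times T^{(m)}_{\min})$ for some $T^{(i)}_{\min}\subseteq S_i$ with $\#T^{(i)}_{\min}=s_i-j_i$ ($i=1,\dots,m$). -/

import Mathlib

open scoped MonomialOrder

/-! ### Linear ramp secret sharing schemes from nested codes -/

/-- The data of the coset construction for nested codes `C₂ ⊆ C₁ ⊆ F^ι` of codimension `ℓ`: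
a basis `b` of `C₂` together with vectors `e` such that `b` followed by `e` is a basis of `C₁`.
The participants are the elements of `ι`. -/
structure RampScheme {F ι : Type*} [Field F] (C₂ C₁ : Submodule F (ι → F)) (k₂ ℓ : ℕ) where
  b : Fin k₂ → ι → F
  e : Fin ℓ → ι → F
  linearIndependent : LinearIndependent F (Sum.elim b e)
  span_b : Submodule.span F (Set.range b) = C₂
  span_b_e : Submodule.span F (Set.range (Sum.elim b e)) = C₁

namespace RampScheme

variable {F ι : Type*} [Field F] {C₂ C₁ : Submodule F (ι → F)} {k₂ ℓ : ℕ}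

/-- The vector of shares of the secret `s` for the random choice `a`. -/
def encode (σ : RampScheme C₂ C₁ k₂ ℓ) (a : Fin k₂ → F) (s : Fin ℓ → F) : ι → F :=
  ∑ i, a i • σ.b i + ∑ i, s i • σ.e i

/-- The secrets that are in accordance with the shares `c p`, `p ∈ A`. -/
def possibleSecrets (σ : RampScheme C₂ C₁ k₂ ℓ) (A : Finset ι) (c : ι → F) :
    Set (Fin ℓ → F) :=
  {s | ∃ a : Fin k₂ → F, ∀ p ∈ A, σ.encode a s p = c p}

/-- The number of `q`-bits of information that `A` holds when the shares are given by `c`: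
the possible secrets form a coset `p + V`, and the information is `ℓ - dim V`. -/
noncomputable def information (σ : RampScheme C₂ C₁ k₂ ℓ) (A : Finset ι) (c : ι → F) : ℕ :=
  ℓ - Module.finrank F (vectorSpan F (σ.possibleSecrets A c))

/-- `A` can recover `i` `q`-bits of information (whatever the secret and the randomness). -/
def Recovers (σ : RampScheme C₂ C₁ k₂ ℓ) (i : ℕ) (A : Finset ι) : Prop :=
  ∀ (a : Fin k₂ → F) (s : Fin ℓ → F), i ≤ σ.information A (σ.encode a s)

/-- `r` is the `i`-th reconstruction number `r_i`: the smallest number such that any set of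
`r` participants can recover `i` `q`-bits of information. -/
def IsReconstructionNumber (σ : RampScheme C₂ C₁ k₂ ℓ) (i r : ℕ) : Prop :=
  IsLeast {r : ℕ | ∀ A : Finset ι, A.card = r → σ.Recovers i A} r

/-- `A` is non-`i`-qualifying. -/
def NonQualifying (σ : RampScheme C₂ C₁ k₂ ℓ) (i : ℕ) (A : Finset ι) : Prop :=
  ¬ σ.Recovers i A

/-- `A` is a non-`i`-qualifying set of largest possible size. -/
def MaximumNonQualifying (σ : RampScheme C₂ C₁ k₂ ℓ) (i : ℕ) (A : Finset ι) : Prop :=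
  σ.NonQualifying i A ∧ ∀ B : Finset ι, σ.NonQualifying i B → B.card ≤ A.card

end RampScheme

/-! ### Monomial-Cartesian codes -/

namespace MonomialCartesian

/-- The point set `S₁ × ⋯ × Sₘ` as a type. -/
abbrev Points {F : Type*} {m : ℕ} (S : Fin m → Finset F) : Type _ :=
  ↥(Fintype.piFinset S)

/-- The subset `T₁ × ⋯ × Tₘ` of `S₁ × ⋯ × Sₘ`. -/
def prodSet {F : Type*} [DecidableEq F] {m : ℕ} (S T : Fin m → Finset F) :
    Finset (Points S) :=
  Finset.univ.filter fun x => ∀ i, x.1 i ∈ T i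

/-- Evaluation of polynomials at the points of `S₁ × ⋯ × Sₘ`. -/
noncomputable def ev {F : Type*} [Field F] {m : ℕ} (S : Fin m → Finset F) :
    MvPolynomial (Fin m) F →ₗ[F] (Points S → F) :=
  LinearMap.pi fun x => (MvPolynomial.aeval x.1).toLinearMap

/-- The code `C(L)`; a monomial is represented by its exponent vector. -/
noncomputable def code {F : Type*} [Field F] {m : ℕ} (S : Fin m → Finset F)
    (L : Finset (Fin m →₀ ℕ)) : Submodule F (Points S → F) :=
  (Submodule.span F
    ((fun M : Fin m →₀ ℕ => MvPolynomial.monomial M (1 : F)) '' (L : Set (Fin m →₀ ℕ)))).map (ev S)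

/-- `Δ(s₁, …, sₘ)`: the monomials with `i`-th exponent smaller than `sᵢ`. -/
noncomputable def delta {m : ℕ} (s : Fin m → ℕ) : Finset (Fin m →₀ ℕ) :=
  Finset.univ.finsupp fun i => Finset.range (s i)

open Classical in
/-- `D(K)`: the number of monomials in `Δ(s₁, …, sₘ)` divisible by some monomial in `K`. -/
noncomputable def D {m : ℕ} (s : Fin m → ℕ) (K : Finset (Fin m →₀ ℕ)) : ℕ :=
  ((delta s).filter fun N => ∃ M ∈ K, M ≤ N).card

/-! ### Considerate schemes -/

/-- `L₁`: all monomials dividing `X₁^{j₁} ⋯ Xₘ^{jₘ}`. -/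
noncomputable def L₁ {m : ℕ} (j : Fin m →₀ ℕ) : Finset (Fin m →₀ ℕ) :=
  Finset.Iic j

/-- `□`: the monomials with `i`-th exponent between `vᵢ` and `jᵢ`. -/
noncomputable def box {m : ℕ} (v j : Fin m →₀ ℕ) : Finset (Fin m →₀ ℕ) :=
  Finset.Icc v j

/-- `L₂ = L₁ \ □`. -/
noncomputable def L₂ {m : ℕ} (v j : Fin m →₀ ℕ) : Finset (Fin m →₀ ℕ) :=
  L₁ j \ box v j

open Classical in
/-- `◇`: the monomials of `L₁` that are at least `X₁^{v₁} ⋯ Xₘ^{vₘ}` in the lexicographic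
ordering with `Xₘ ≺ ⋯ ≺ X₁`. -/
noncomputable def diamond {m : ℕ} (v j : Fin m →₀ ℕ) : Finset (Fin m →₀ ℕ) :=
  (L₁ j).filter fun M => v ≼[MonomialOrder.lex] M

/-- For every `i = 1, …, #□`, the minimum of `D(K)` over the `K ⊆ ◇` of size `i` is attained
by some `K' ⊆ □`. -/
def Considerate {m : ℕ} (s : Fin m → ℕ) (v j : Fin m →₀ ℕ) : Prop :=
  ∀ i : ℕ, 1 ≤ i → i ≤ (box v j).card →
    ∃ K' : Finset (Fin m →₀ ℕ), K' ⊆ box v j ∧ K'.card = i ∧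
      ∀ K : Finset (Fin m →₀ ℕ), K ⊆ diamond v j → K.card = i → D s K' ≤ D s K

end MonomialCartesian

/-! The secrets compatible with given shares form a coset of `hidden A`, a subspace depending only
on `A`. So `A` is non-`1`-qualifying iff the words of `C₁` vanishing on `A` represent all of
`C₁/C₂`, and non-`ℓ`-qualifying iff some word of `C₁ \ C₂` vanishes on `A`.

For `ℓ`: a nonzero word of `C(L₁)` restricts to each axis-parallel line as a polynomial of degree at
most `jᵢ`, so its support meets the line in no or at least `sᵢ - jᵢ` points. By
`prod_le_card_of_lines` the support has at least `∏ (sᵢ - jᵢ)` points, with equality only for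
products. Products of linear factors attain this (`exists_ev_eq_zero_of_card`).

For `1`: representatives of the classes of the box monomials, all vanishing on `A`, span a space of
dimension `#□`, which has that many leading monomials, all in `◇`. The footprint bound
`card_add_D_le` and considerateness give `#A ≤ n - D(□)`, where `D(□) = ∏ (sᵢ - vᵢ)`. Equality is
attained because multiples of a product of linear factors with leading monomial `X^v` reduce every
box monomial modulo `C(L₂)` (`exists_sub_mem_code`). -/

namespace RampScheme

/-! ### Qualification in terms of codewords -/

variable {F ι : Type*} [Field F] {C₂ C₁ : Submodule F (ι → F)} {k₂ ℓ : ℕ}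

theorem encode_sub (σ : RampScheme C₂ C₁ k₂ ℓ) (a a' : Fin k₂ → F) (s s' : Fin ℓ → F) :
    σ.encode (a - a') (s - s') = σ.encode a s - σ.encode a' s' := by
  simp only [encode, Pi.sub_apply, sub_smul, Finset.sum_sub_distrib]
  abel

theorem encode_add (σ : RampScheme C₂ C₁ k₂ ℓ) (a a' : Fin k₂ → F) (s s' : Fin ℓ → F) :
    σ.encode (a + a') (s + s') = σ.encode a s + σ.encode a' s' := by
  simp only [encode, Pi.add_apply, add_smul, Finset.sum_add_distrib]
  abel

theorem encode_smul (σ : RampScheme C₂ C₁ k₂ ℓ) (t : F) (a : Fin k₂ → F) (s : Fin ℓ → F) :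
    σ.encode (t • a) (t • s) = t • σ.encode a s := by
  simp only [encode, Pi.smul_apply, smul_eq_mul, mul_smul, Finset.smul_sum, smul_add]

theorem encode_zero (σ : RampScheme C₂ C₁ k₂ ℓ) : σ.encode 0 0 = 0 := by
  simp [encode]

/-- The secrets in accordance with the zero shares: the direction of all cosets of possible
secrets. -/
def hidden (σ : RampScheme C₂ C₁ k₂ ℓ) (A : Finset ι) : Submodule F (Fin ℓ → F) where
  carrier := σ.possibleSecrets A 0
  zero_mem' := ⟨0, fun p _ => by rw [encode_zero]⟩
  add_mem' := by
    rintro s s' ⟨a, ha⟩ ⟨a', ha'⟩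
    exact ⟨a + a', fun p hp => by simp [encode_add, ha p hp, ha' p hp]⟩
  smul_mem' := by
    rintro t s ⟨a, ha⟩
    exact ⟨t • a, fun p hp => by simp [encode_smul, ha p hp]⟩

theorem mem_hidden {σ : RampScheme C₂ C₁ k₂ ℓ} {A : Finset ι} {s : Fin ℓ → F} :
    s ∈ σ.hidden A ↔ ∃ a, ∀ p ∈ A, σ.encode a s p = 0 := Iff.rfl

/-- Two secrets with equal shares on `A` differ by one with zero shares, and adding such a
difference to `s` changes no share. Hence the information held by `A` does not depend on the shares.
-/
theorem vectorSpan_possibleSecrets (σ : RampScheme C₂ C₁ k₂ ℓ) (A : Finset ι)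
    (a : Fin k₂ → F) (s : Fin ℓ → F) :
    vectorSpan F (σ.possibleSecrets A (σ.encode a s)) = σ.hidden A := by
  apply le_antisymm
  · rw [vectorSpan_def, Submodule.span_le]
    rintro _ ⟨s₁, ⟨a₁, h₁⟩, s₂, ⟨a₂, h₂⟩, rfl⟩
    exact ⟨a₁ - a₂, fun p hp => by simp [encode_sub, h₁ p hp, h₂ p hp]⟩
  · rintro t ⟨b, hb⟩
    have h₁ : t + s ∈ σ.possibleSecrets A (σ.encode a s) :=
      ⟨b + a, fun p hp => by simp [encode_add, hb p hp]⟩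
    have h₂ : s ∈ σ.possibleSecrets A (σ.encode a s) := ⟨a, fun _ _ => rfl⟩
    simpa using vsub_mem_vectorSpan F h₁ h₂

theorem recovers_iff {σ : RampScheme C₂ C₁ k₂ ℓ} {i : ℕ} {A : Finset ι} :
    σ.Recovers i A ↔ i ≤ ℓ - Module.finrank F (σ.hidden A) := by
  have h : ∀ a s, Module.finrank F (vectorSpan F (σ.possibleSecrets A (σ.encode a s))) =
      Module.finrank F (σ.hidden A) := fun a s => by rw [vectorSpan_possibleSecrets]
  simp only [Recovers, information, h, forall_const]

theorem finrank_hidden_le (σ : RampScheme C₂ C₁ k₂ ℓ) (A : Finset ι) :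
    Module.finrank F (σ.hidden A) ≤ ℓ := by
  simpa using (σ.hidden A).finrank_le

theorem hidden_anti (σ : RampScheme C₂ C₁ k₂ ℓ) {A B : Finset ι} (h : B ⊆ A) :
    σ.hidden A ≤ σ.hidden B :=
  fun _ ⟨a, ha⟩ => ⟨a, fun p hp => ha p (h hp)⟩

theorem NonQualifying.mono {σ : RampScheme C₂ C₁ k₂ ℓ} {i : ℕ} {A B : Finset ι}
    (hA : σ.NonQualifying i A) (h : B ⊆ A) : σ.NonQualifying i B := by
  rw [NonQualifying, recovers_iff] at *
  have := Submodule.finrank_mono (σ.hidden_anti h)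
  omega

theorem encode_mem (σ : RampScheme C₂ C₁ k₂ ℓ) (a : Fin k₂ → F) (s : Fin ℓ → F) :
    σ.encode a s ∈ C₁ := by
  refine σ.span_b_e.le ?_
  refine Submodule.add_mem _ (Submodule.sum_mem _ fun i _ => Submodule.smul_mem _ _ ?_)
    (Submodule.sum_mem _ fun i _ => Submodule.smul_mem _ _ ?_)
  · exact Submodule.subset_span ⟨Sum.inl i, rfl⟩
  · exact Submodule.subset_span ⟨Sum.inr i, rfl⟩

theorem encode_eq_linearCombination (σ : RampScheme C₂ C₁ k₂ ℓ) (x : Fin k₂ ⊕ Fin ℓ → F) :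
    σ.encode (x ∘ Sum.inl) (x ∘ Sum.inr) = ∑ i, x i • Sum.elim σ.b σ.e i := by
  simp [encode]

theorem exists_encode_eq (σ : RampScheme C₂ C₁ k₂ ℓ) {c : ι → F} (hc : c ∈ C₁) :
    ∃ a s, σ.encode a s = c := by
  rw [← σ.span_b_e, Submodule.mem_span_range_iff_exists_fun] at hc
  obtain ⟨x, rfl⟩ := hc
  exact ⟨_, _, σ.encode_eq_linearCombination x⟩

theorem exists_encode_zero_eq (σ : RampScheme C₂ C₁ k₂ ℓ) {c : ι → F} (hc : c ∈ C₂) :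
    ∃ a, σ.encode a 0 = c := by
  rw [← σ.span_b, Submodule.mem_span_range_iff_exists_fun] at hc
  obtain ⟨x, rfl⟩ := hc
  exact ⟨x, by simp [encode]⟩

theorem encode_mem_iff (σ : RampScheme C₂ C₁ k₂ ℓ) {a : Fin k₂ → F} {s : Fin ℓ → F} :
    σ.encode a s ∈ C₂ ↔ s = 0 := by
  constructor
  · intro h
    obtain ⟨a', ha'⟩ := σ.exists_encode_zero_eq h
    have h0 : σ.encode (a - a') s = 0 := by
      rw [← sub_zero s, encode_sub, ha', sub_self]
    have := Fintype.linearIndependent_iff.1 σ.linearIndependent (Sum.elim (a - a') s) (by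
      rw [← encode_eq_linearCombination]; simpa using h0)
    ext i
    simpa using this (Sum.inr i)
  · rintro rfl
    refine σ.span_b.le ?_
    simp only [encode, Pi.zero_apply, zero_smul, Finset.sum_const_zero, add_zero]
    exact Submodule.sum_mem _ fun i _ => Submodule.smul_mem _ _ (Submodule.subset_span ⟨i, rfl⟩)

/-- A set learns nothing about the secret iff every class of `C₁ / C₂` contains a codeword
vanishing on it. -/
theorem nonQualifying_one_iff {σ : RampScheme C₂ C₁ k₂ ℓ} {A : Finset ι} :
    σ.NonQualifying 1 A ↔ ∀ c ∈ C₁, ∃ c' ∈ C₁, c - c' ∈ C₂ ∧ ∀ p ∈ A, c' p = 0 := by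
  have h1 : σ.NonQualifying 1 A ↔ σ.hidden A = ⊤ := by
    rw [NonQualifying, recovers_iff]
    have := σ.finrank_hidden_le A
    constructor
    · intro h
      apply Submodule.eq_top_of_finrank_eq
      simp only [Module.finrank_fintype_fun_eq_card, Fintype.card_fin]
      omega
    · intro h
      have h2 : Module.finrank F (σ.hidden A) = ℓ := by
        rw [h, finrank_top, Module.finrank_fintype_fun_eq_card, Fintype.card_fin]
      omega
  rw [h1]
  constructor
  · intro h c hc
    obtain ⟨a, s, rfl⟩ := σ.exists_encode_eq hc
    obtain ⟨a', ha'⟩ := mem_hidden.1 (h ▸ Submodule.mem_top : s ∈ σ.hidden A)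
    refine ⟨_, σ.encode_mem a' s, ?_, ha'⟩
    rw [← encode_sub, encode_mem_iff, sub_self]
  · intro h
    rw [eq_top_iff]
    intro s _
    obtain ⟨c, hc, h2, h3⟩ := h _ (σ.encode_mem 0 s)
    obtain ⟨a, s', rfl⟩ := σ.exists_encode_eq hc
    rw [← encode_sub, encode_mem_iff, sub_eq_zero] at h2
    exact ⟨a, h2 ▸ h3⟩

/-- A set cannot determine the whole secret iff some codeword of `C₁ \ C₂` vanishes on it. -/
theorem nonQualifying_codim_iff {σ : RampScheme C₂ C₁ k₂ ℓ} {A : Finset ι} :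
    σ.NonQualifying ℓ A ↔ ∃ c ∈ C₁, c ∉ C₂ ∧ ∀ p ∈ A, c p = 0 := by
  have h1 : σ.NonQualifying ℓ A ↔ σ.hidden A ≠ ⊥ := by
    rw [NonQualifying, recovers_iff, Ne, ← Submodule.finrank_eq_zero (R := F)]
    have := σ.finrank_hidden_le A
    omega
  rw [h1, Submodule.ne_bot_iff]
  constructor
  · rintro ⟨s, ⟨a, ha⟩, hs⟩
    exact ⟨_, σ.encode_mem a s, fun h => hs (σ.encode_mem_iff.1 h), ha⟩
  · rintro ⟨c, hc, h2, h3⟩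
    obtain ⟨a, s, rfl⟩ := σ.exists_encode_eq hc
    exact ⟨s, ⟨a, h3⟩, fun h => h2 (σ.encode_mem_iff.2 h)⟩

/-- Subsets of non-qualifying sets are non-qualifying, so every size up to `A.card` fails, and by
maximality the next size succeeds. -/
theorem isReconstructionNumber_of_maximumNonQualifying {σ : RampScheme C₂ C₁ k₂ ℓ} {i : ℕ}
    {A : Finset ι} (hA : σ.MaximumNonQualifying i A) :
    σ.IsReconstructionNumber i (A.card + 1) := by
  constructor
  · intro B hB
    by_contra h
    have := hA.2 B h
    omega
  · intro r hr
    by_contra! h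
    obtain ⟨B, hB, hBr⟩ := Finset.exists_subset_card_eq (Nat.le_of_lt_succ h)
    exact hA.1.mono hB (hr B hBr)

theorem finrank_left (σ : RampScheme C₂ C₁ k₂ ℓ) : Module.finrank F C₂ = k₂ := by
  rw [← σ.span_b]
  have h : LinearIndependent F σ.b := σ.linearIndependent.comp Sum.inl Sum.inl_injective
  rw [finrank_span_eq_card h, Fintype.card_fin]

theorem finrank_right (σ : RampScheme C₂ C₁ k₂ ℓ) : Module.finrank F C₁ = k₂ + ℓ := by
  rw [← σ.span_b_e]
  rw [finrank_span_eq_card σ.linearIndependent, Fintype.card_sum, Fintype.card_fin,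
    Fintype.card_fin]

end RampScheme

/-! ### Sets with many points on lines -/

/-- A nonempty set that meets every axis-parallel line in direction `i` in no or in at least
`d i` points has at least `∏ d i` elements, and in case of equality it is a product. -/
theorem prod_le_card_of_lines {α : Type*} [Fintype α] [DecidableEq α] {m : ℕ}
    (X : Finset (Fin m → α)) (d : Fin m → ℕ) (hd : ∀ i, 0 < d i) (hne : X.Nonempty)
    (hX : ∀ x ∈ X, ∀ i, d i ≤ (Finset.univ.filter fun t => Function.update x i t ∈ X).card) :
    ∏ i, d i ≤ X.card ∧
      (X.card = ∏ i, d i → ∃ T : Fin m → Finset α, (∀ i, (T i).card = d i) ∧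
        X = Fintype.piFinset T) := by
  induction m with
  | zero =>
    refine ⟨by simpa using hne, fun _ => ⟨fun i => i.elim0, fun i => i.elim0, ?_⟩⟩
    ext x
    obtain ⟨y, hy⟩ := hne
    have hx : x ∈ X := Subsingleton.elim y x ▸ hy
    exact iff_of_true hx (Fintype.mem_piFinset.2 fun i => i.elim0)
  | succ m ih =>
    -- Slice by the first coordinate; `T₀` indexes the nonempty slices. Lines in direction `0` bound
    -- `T₀.card`, while the other lines stay inside one slice, where induction applies.
    let Y : α → Finset (Fin m → α) := fun a =>
      Finset.univ.filter fun y => (Fin.cons a y : Fin (m + 1) → α) ∈ X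
    have hmem : ∀ a y, y ∈ Y a ↔ (Fin.cons a y : Fin (m + 1) → α) ∈ X := by simp [Y]
    let T₀ : Finset α := Finset.univ.filter fun a => (Y a).Nonempty
    have hT₀ : ∀ a, a ∈ T₀ ↔ (Y a).Nonempty := by simp [T₀]
    have hsum : X.card = ∑ a ∈ T₀, (Y a).card := by
      have h1 : X.card = ∑ a, (Y a).card := by
        rw [Finset.card_eq_sum_card_fiberwise (f := fun x => x 0) (t := Finset.univ)
          (fun _ _ => Finset.mem_coe.2 (Finset.mem_univ _))]
        refine Finset.sum_congr rfl fun a _ => ?_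
        refine Finset.card_bij' (fun x _ => Fin.tail x) (fun y _ => Fin.cons a y) ?_ ?_ ?_ ?_
        · intro x hx
          obtain ⟨hx', rfl⟩ := Finset.mem_filter.1 hx
          rw [hmem, Fin.cons_self_tail]
          exact hx'
        · intro y hy
          exact Finset.mem_filter.2 ⟨(hmem _ _).1 hy, rfl⟩
        · intro x hx
          obtain ⟨hx, rfl⟩ := Finset.mem_filter.1 hx
          exact Fin.cons_self_tail x
        · intro y hy
          exact Fin.tail_cons _ _
      rw [h1]
      refine (Finset.sum_subset (Finset.subset_univ _) fun a _ ha => ?_).symm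
      rw [hT₀, Finset.not_nonempty_iff_eq_empty] at ha
      simp [ha]
    have hline : ∀ a y, y ∈ Y a → d 0 ≤ (Finset.univ.filter fun t => y ∈ Y t).card := by
      intro a y hy
      simpa [Fin.update_cons_zero, hmem] using hX _ ((hmem a y).1 hy) 0
    have hsub : ∀ y, (Finset.univ.filter fun t => y ∈ Y t) ⊆ T₀ := by
      intro y t ht
      exact (hT₀ t).2 ⟨y, by simpa using ht⟩
    have hih := fun a (ha : a ∈ T₀) =>
      ih (Y a) (fun i => d i.succ) (fun i => hd _) ((hT₀ a).1 ha) (by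
        intro y hy i
        simpa [← Fin.cons_update, hmem] using hX _ ((hmem a y).1 hy) i.succ)
    obtain ⟨x, hx⟩ := hne
    have hx0 : Fin.tail x ∈ Y (x 0) := by rwa [hmem, Fin.cons_self_tail]
    have hT₀card : d 0 ≤ T₀.card := (hline _ _ hx0).trans (Finset.card_le_card (hsub _))
    have hxT : x 0 ∈ T₀ := (hT₀ _).2 ⟨_, hx0⟩
    have hP : 0 < ∏ i : Fin m, d i.succ := Finset.prod_pos fun i _ => hd _
    have hlow : T₀.card * ∏ i : Fin m, d i.succ ≤ X.card := by
      rw [hsum, ← smul_eq_mul]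
      exact Finset.card_nsmul_le_sum _ _ _ fun a ha => (hih a ha).1
    rw [Fin.prod_univ_succ]
    refine ⟨(Nat.mul_le_mul_right _ hT₀card).trans hlow, fun heq => ?_⟩
    have hcard : T₀.card = d 0 :=
      le_antisymm (Nat.le_of_mul_le_mul_right (heq ▸ hlow) hP) hT₀card
    -- Equality forces `T₀.card = d 0`, so each line in direction `0` that meets `X` fills `T₀`;
    -- hence all nonempty slices coincide.
    have hfull : ∀ a y, y ∈ Y a → (Finset.univ.filter fun t => y ∈ Y t) = T₀ := fun a y hy =>
      Finset.eq_of_subset_of_card_le (hsub y) (hcard ▸ hline a y hy)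
    have hYeq : ∀ a ∈ T₀, Y a = Y (x 0) := by
      intro a ha
      ext y
      constructor
      · intro hy
        have := hfull a y hy ▸ hxT
        simpa using this
      · intro hy
        have := hfull _ y hy ▸ ha
        simpa using this
    have hYcard : (Y (x 0)).card = ∏ i : Fin m, d i.succ := by
      rw [Finset.sum_congr rfl fun a ha => by rw [hYeq a ha], Finset.sum_const, hcard,
        smul_eq_mul, heq] at hsum
      exact (Nat.eq_of_mul_eq_mul_left (hd 0) hsum).symm
    obtain ⟨T, hT, hYT⟩ := (hih _ hxT).2 hYcard
    refine ⟨Fin.cons T₀ T, fun i => ?_, ?_⟩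
    · refine Fin.cases ?_ (fun i => ?_) i
      · simpa using hcard
      · simpa using hT i
    · ext z
      have hz : z ∈ X ↔ Fin.tail z ∈ Y (z 0) := by rw [hmem, Fin.cons_self_tail]
      rw [hz, Fintype.mem_piFinset, Fin.forall_fin_succ]
      simp only [Fin.cons_zero, Fin.cons_succ]
      constructor
      · intro h
        have h0 : z 0 ∈ T₀ := (hT₀ _).2 ⟨_, h⟩
        rw [hYeq _ h0, hYT, Fintype.mem_piFinset] at h
        exact ⟨h0, h⟩
      · rintro ⟨h0, h⟩
        rw [hYeq _ h0, hYT, Fintype.mem_piFinset]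
        exact h

/-! ### Evaluation on a Cartesian product -/

namespace MonomialCartesian

open MvPolynomial

theorem card_points {F : Type*} {m : ℕ} (S : Fin m → Finset F) :
    Fintype.card (Points S) = ∏ i, (S i).card := by
  rw [Fintype.card_coe, Fintype.card_piFinset]

theorem card_prodSet {F : Type*} [DecidableEq F] {m : ℕ} {S T : Fin m → Finset F}
    (hT : ∀ i, T i ⊆ S i) : (prodSet S T).card = ∏ i, (T i).card := by
  rw [← Fintype.card_piFinset]
  refine Finset.card_bij (fun x _ => x.1) (fun x hx => ?_) (fun x _ y _ h => Subtype.ext h)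
    fun x hx => ?_
  · simpa [prodSet, Fintype.mem_piFinset] using hx
  · have h := Fintype.mem_piFinset.1 hx
    exact ⟨⟨x, Fintype.mem_piFinset.2 fun i => hT i (h i)⟩, by simpa [prodSet] using h, rfl⟩

variable {F : Type*} [Field F] {m : ℕ}

theorem code_eq (S : Fin m → Finset F) (L : Finset (Fin m →₀ ℕ)) :
    code S L = (restrictSupport F (L : Set (Fin m →₀ ℕ))).map (ev S) := by
  rw [restrictSupport_eq_span]
  rfl

theorem mem_code {S : Fin m → Finset F} {L : Finset (Fin m →₀ ℕ)} {c : Points S → F} :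
    c ∈ code S L ↔ ∃ f : MvPolynomial (Fin m) F, f.support ⊆ L ∧ ev S f = c := by
  rw [code_eq, Submodule.mem_map]
  simp only [mem_restrictSupport_iff, Finset.coe_subset]

theorem ev_apply (S : Fin m → Finset F) (f : MvPolynomial (Fin m) F) (x : Points S) :
    ev S f x = eval x.1 f := by
  simp [ev, aeval_eq_eval]

theorem mem_delta {s : Fin m → ℕ} {M : Fin m →₀ ℕ} : M ∈ delta s ↔ ∀ i, M i < s i := by
  simp [delta, Finset.mem_finsupp_iff]

/-- A polynomial of degree less than `sᵢ` in each variable is determined by its values on the grid.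
Thus coefficients can be read off codewords. -/
theorem eq_zero_of_ev_eq_zero {S : Fin m → Finset F} {f : MvPolynomial (Fin m) F}
    (hf : f.support ⊆ delta fun i => (S i).card) (h : ev S f = 0) : f = 0 := by
  by_contra hne
  obtain ⟨M, hM⟩ := support_nonempty.2 hne
  refine hne (eq_zero_of_eval_zero_at_prod_finset f S (fun i => ?_) fun x hx => ?_)
  · rw [degreeOf_lt_iff (Nat.zero_lt_of_lt (mem_delta.1 (hf hM) i))]
    exact fun N hN => mem_delta.1 (hf hN) i
  · rw [← ev_apply S f ⟨x, Fintype.mem_piFinset.2 hx⟩, h, Pi.zero_apply]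

theorem eq_of_ev_eq {S : Fin m → Finset F} {f g : MvPolynomial (Fin m) F}
    (hf : f.support ⊆ delta fun i => (S i).card)
    (hg : g.support ⊆ delta fun i => (S i).card) (h : ev S f = ev S g) : f = g := by
  classical
  refine sub_eq_zero.1 (eq_zero_of_ev_eq_zero (S := S) ?_ (by rw [map_sub, h, sub_self]))
  exact (support_sub _ _ _).trans (Finset.union_subset hf hg)

theorem finrank_restrictSupport (L : Finset (Fin m →₀ ℕ)) :
    Module.finrank F (restrictSupport F (L : Set (Fin m →₀ ℕ))) = L.card := by
  rw [Module.finrank_eq_card_basis (basisRestrictSupport F (L : Set (Fin m →₀ ℕ)))]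
  simp

theorem finrank_code {S : Fin m → Finset F} {L : Finset (Fin m →₀ ℕ)}
    (hL : L ⊆ delta fun i => (S i).card) : Module.finrank F (code S L) = L.card := by
  rw [code_eq, ← finrank_restrictSupport (F := F) L, ← LinearMap.range_domRestrict]
  refine LinearMap.finrank_range_of_inj ((injective_iff_map_eq_zero _).2 fun f hf => ?_)
  exact Subtype.ext (eq_zero_of_ev_eq_zero ((Finset.coe_subset.1 f.2).trans hL) hf)

/-- The restriction of a polynomial to an axis-parallel line. -/
theorem exists_polynomial_line (f : MvPolynomial (Fin m) F) (x : Fin m → F) (i : Fin m) :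
    ∃ p : Polynomial F, p.natDegree ≤ f.degreeOf i ∧
      ∀ t, p.eval t = eval (Function.update x i t) f := by
  refine ⟨∑ M ∈ f.support, Polynomial.C (f.coeff M * ∏ k ∈ Finset.univ.erase i, x k ^ M k) *
    Polynomial.X ^ M i, ?_, fun t => ?_⟩
  · refine Polynomial.natDegree_sum_le_of_forall_le _ _ fun M hM => ?_
    exact (Polynomial.natDegree_C_mul_X_pow_le _ _).trans (monomial_le_degreeOf i hM)
  · rw [eval_eq', Polynomial.eval_finsetSum]
    refine Finset.sum_congr rfl fun M _ => ?_
    rw [← Finset.mul_prod_erase _ _ (Finset.mem_univ i), Function.update_self]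
    simp only [Polynomial.eval_mul, Polynomial.eval_C, Polynomial.eval_pow, Polynomial.eval_X]
    have h : ∏ k ∈ Finset.univ.erase i, Function.update x i t k ^ M k =
        ∏ k ∈ Finset.univ.erase i, x k ^ M k :=
      Finset.prod_congr rfl fun k hk => by
        rw [Function.update_of_ne (Finset.ne_of_mem_erase hk)]
    rw [h]
    ring

/-! ### Products of linear factors -/

theorem degree_linear_prod (R : Finset F) (i : Fin m) :
    MonomialOrder.lex.degree (∏ a ∈ R, (X i - C a : MvPolynomial (Fin m) F)) =
      Finsupp.single i R.card := by
  rw [MonomialOrder.degree_prod fun a _ =>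
    (MonomialOrder.monic_X_sub_C MonomialOrder.lex i a).ne_zero]
  simp [MonomialOrder.degree_X_sub_C]

theorem monic_linear_prod (R : Finset F) (i : Fin m) :
    MonomialOrder.lex.Monic (∏ a ∈ R, (X i - C a : MvPolynomial (Fin m) F)) :=
  MonomialOrder.Monic.prod fun a _ => MonomialOrder.monic_X_sub_C _ i a

/-- The product of the linear polynomials `Xᵢ - a` with `a ∈ Sᵢ \ Tᵢ`. -/
noncomputable def vanishing [DecidableEq F] (S T : Fin m → Finset F) : MvPolynomial (Fin m) F :=
  ∏ i, ∏ a ∈ S i \ T i, (X i - C a)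

section vanishing

variable [DecidableEq F] {S T : Fin m → Finset F}

theorem monic_vanishing : MonomialOrder.lex.Monic (vanishing S T) :=
  MonomialOrder.Monic.prod fun i _ => MonomialOrder.Monic.prod fun _ _ =>
    MonomialOrder.monic_X_sub_C _ i _

theorem degree_vanishing {w : Fin m →₀ ℕ} (hw : ∀ i, (S i \ T i).card = w i) :
    MonomialOrder.lex.degree (vanishing S T) = w := by
  rw [vanishing, MonomialOrder.degree_prod fun i _ => (monic_linear_prod _ i).ne_zero]
  simp only [degree_linear_prod, hw]
  exact Finsupp.univ_sum_single w

theorem coeff_vanishing {w : Fin m →₀ ℕ} (hw : ∀ i, (S i \ T i).card = w i) :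
    (vanishing S T).coeff w = 1 := by
  have := (monic_vanishing (S := S) (T := T)).coeff_degree
  rwa [degree_vanishing hw] at this

theorem degreeOf_vanishing_le (k : Fin m) :
    (vanishing S T).degreeOf k ≤ (S k \ T k).card := by
  have h : ∀ (i : Fin m) (a : F),
      (X i - C a : MvPolynomial (Fin m) F).degreeOf k ≤ if k = i then 1 else 0 := by
    intro i a
    rw [sub_eq_add_neg, ← C_neg]
    refine (degreeOf_add_le _ _ _).trans ?_
    simp [degreeOf_X]
  refine (degreeOf_prod_le _ _ _).trans ?_
  calc _ ≤ ∑ i, ∑ a ∈ S i \ T i, if k = i then 1 else 0 :=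
        Finset.sum_le_sum fun i _ => (degreeOf_prod_le _ _ _).trans
          (Finset.sum_le_sum fun a _ => h i a)
    _ = _ := by simp

/-- Bounding the degree in each variable separately gives divisibility, which is stronger than
lexicographic comparison with the leading monomial. -/
theorem le_of_mem_support_vanishing {w M : Fin m →₀ ℕ} (hw : ∀ i, (S i \ T i).card = w i)
    (hM : M ∈ (vanishing S T).support) : M ≤ w := fun i =>
  (monomial_le_degreeOf i hM).trans ((degreeOf_vanishing_le i).trans (hw i).le)

theorem eval_vanishing {x : Fin m → F} {i : Fin m} (hx : x i ∈ S i) (hxT : x i ∉ T i) :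
    eval x (vanishing S T) = 0 := by
  rw [vanishing, map_prod]
  refine Finset.prod_eq_zero (Finset.mem_univ i) ?_
  rw [map_prod]
  exact Finset.prod_eq_zero (Finset.mem_sdiff.2 ⟨hx, hxT⟩) (by simp)

theorem ev_mul_vanishing (f : MvPolynomial (Fin m) F) {p : Points S}
    (hp : p ∈ Finset.univ \ prodSet S T) : ev S (f * vanishing S T) p = 0 := by
  simp only [prodSet, Finset.mem_sdiff, Finset.mem_univ, true_and, Finset.mem_filter,
    not_forall] at hp
  obtain ⟨i, hi⟩ := hp
  rw [ev_apply, map_mul, eval_vanishing (Fintype.mem_piFinset.1 p.2 i) hi, mul_zero]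

end vanishing

/-! ### The footprint bound -/

/-- The footprint bound: the number of common zeros of a set of nonzero polynomials in the
Cartesian product is at most the number of monomials in `Δ` that are divisible by no leading
monomial. -/
theorem card_add_D_le [Fintype F] (S : Fin m → Finset F) (A : Finset (Points S))
    (B : Set (MvPolynomial (Fin m) F)) (hB : ∀ f ∈ B, f ≠ 0)
    (hA : ∀ f ∈ B, ∀ p ∈ A, ev S f p = 0) (K : Finset (Fin m →₀ ℕ))
    (hK : ∀ M ∈ K, ∃ f ∈ B, MonomialOrder.lex.degree f = M) :
    A.card + D (fun i => (S i).card) K ≤ ∏ i, (S i).card := by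
  classical
  set s : Fin m → ℕ := fun i => (S i).card
  let L : Finset (Fin m →₀ ℕ) := (delta s).filter fun N => ¬ ∃ M ∈ K, M ≤ N
  have hcard : L.card + D s K = ∏ i, s i := by
    rw [D, add_comm, Finset.card_filter_add_card_filter_not, delta, Finset.card_finsupp]
    simp
  rw [← hcard]
  refine Nat.add_le_add_right ?_ _
  let φ : MvPolynomial (Fin m) F →ₗ[F] (A → F) :=
    (LinearMap.funLeft F F (Subtype.val : A → Points S)).comp (ev S)
  have hφ : ∀ f (p : A), φ f p = eval p.1.1 f := fun f p => ev_apply S f p.1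
  -- It suffices that polynomials supported on `L` interpolate every function on `A`; comparing
  -- dimensions then gives the bound.
  have hsurj : Function.Surjective (φ.domRestrict (restrictSupport F (L : Set _))) := by
    intro g
    obtain ⟨f, hf⟩ : ∃ f : MvPolynomial (Fin m) F, φ f = g := by
      -- Over a finite field every function on `F^m` is polynomial, so extend `g` by `0` off `A`.
      let G : (Fin m → F) → F := fun x => if h : ∃ p : A, p.1.1 = x then g h.choose else 0
      have hG : G ∈ (restrictDegree (Fin m) F (Fintype.card F - 1)).map (evalₗ F (Fin m)) := by
        rw [map_restrict_dom_evalₗ]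
        trivial
      obtain ⟨f, -, hf⟩ := hG
      refine ⟨f, funext fun p => ?_⟩
      have h : ∃ q : A, q.1.1 = p.1.1 := ⟨p, rfl⟩
      have h1 : eval p.1.1 f = G p.1.1 := congrFun hf _
      rw [hφ, h1]
      simp only [G, dif_pos h]
      exact congrArg g (Subtype.ext (Subtype.ext h.choose_spec))
    -- The added polynomials vanish on the grid and have leading monomials `Xᵢ^sᵢ`. Division by `B'`
    -- keeps the values on `A` and leaves a remainder supported on `L`.
    let B' : Set (MvPolynomial (Fin m) F) :=
      B ∪ Set.range fun i : Fin m => ∏ a ∈ S i, (X i - C a)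
    have hB' : ∀ b ∈ B', IsUnit (MonomialOrder.lex.leadingCoeff b) := by
      rintro b (hb | ⟨i, rfl⟩)
      · exact (MonomialOrder.leadingCoeff_ne_zero_iff.2 (hB b hb)).isUnit
      · rw [(monic_linear_prod (S i) i).leadingCoeff_eq_one]
        exact isUnit_one
    have hvan : ∀ b ∈ B', φ b = 0 := by
      rintro b (hb | ⟨i, rfl⟩)
      · exact funext fun p => hA b hb p.1 p.2
      · refine funext fun p => ?_
        rw [hφ, map_prod]
        exact Finset.prod_eq_zero (Fintype.mem_piFinset.1 p.1.2 i) (by simp)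
    obtain ⟨h, r, hfr, -, hr⟩ := MonomialOrder.lex.div_set hB' f
    refine ⟨⟨r, ?_⟩, ?_⟩
    · rw [mem_restrictSupport_iff, Finset.coe_subset]
      intro N hN
      refine Finset.mem_filter.2 ⟨mem_delta.2 fun i => ?_, ?_⟩
      · have := hr N hN _ (Or.inr ⟨i, rfl⟩)
        rw [degree_linear_prod, Finsupp.single_le_iff] at this
        exact not_le.1 this
      · rintro ⟨M, hM, hMN⟩
        obtain ⟨b, hb, rfl⟩ := hK M hM
        exact hr N hN b (Or.inl hb) hMN
    · change φ r = g
      rw [← hf]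
      funext p
      have h0 : eval p.1.1
          (Finsupp.linearCombination _ (fun b : B' => (b : MvPolynomial (Fin m) F)) h) = 0 := by
        rw [Finsupp.linearCombination_apply, Finsupp.sum, map_sum]
        refine Finset.sum_eq_zero fun b _ => ?_
        rw [smul_eq_mul, map_mul, ← hφ b.1 p, hvan b.1 b.2, Pi.zero_apply, mul_zero]
      rw [hφ, hφ, hfr, map_add, h0, zero_add]
  have : Module.Finite F (restrictSupport F (L : Set (Fin m →₀ ℕ))) :=
    Module.Finite.of_basis (basisRestrictSupport F (L : Set (Fin m →₀ ℕ)))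
  have := LinearMap.finrank_le_finrank_of_surjective hsurj
  rw [finrank_restrictSupport] at this
  simpa using this

end MonomialCartesian

/-! ### Counting in the box and in products -/

namespace MonomialCartesian

open MvPolynomial

theorem mem_L₁ {m : ℕ} {j M : Fin m →₀ ℕ} : M ∈ L₁ j ↔ M ≤ j := Finset.mem_Iic

theorem mem_box {m : ℕ} {v j M : Fin m →₀ ℕ} : M ∈ box v j ↔ v ≤ M ∧ M ≤ j := Finset.mem_Icc

theorem mem_L₂ {m : ℕ} {v j M : Fin m →₀ ℕ} : M ∈ L₂ v j ↔ M ≤ j ∧ M ∉ box v j := by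
  rw [L₂, Finset.mem_sdiff, mem_L₁]

theorem L₂_subset_L₁ {m : ℕ} {v j : Fin m →₀ ℕ} : L₂ v j ⊆ L₁ j := Finset.sdiff_subset

theorem L₁_subset_delta {m : ℕ} {s : Fin m → ℕ} {j : Fin m →₀ ℕ} (hj : ∀ i, j i < s i) :
    L₁ j ⊆ delta s := fun _ hM => mem_delta.2 fun i => (mem_L₁.1 hM i).trans_lt (hj i)

/-- As `v` itself lies in the box and divides all its elements, divisibility by some box element is
divisibility by `X^v`. -/
theorem D_box {m : ℕ} {s : Fin m → ℕ} {v j : Fin m →₀ ℕ} (hvj : v ≤ j) :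
    D s (box v j) = ∏ i, (s i - v i) := by
  classical
  have h : ((delta s).filter fun N => ∃ M ∈ box v j, M ≤ N) =
      Finset.univ.finsupp fun i => Finset.Ico (v i) (s i) := by
    ext N
    simp only [Finset.mem_filter, mem_delta, Finset.mem_finsupp_iff, Finset.subset_univ,
      Finset.mem_univ, true_and, forall_const, Finset.mem_Ico, forall_and,
      and_comm (b := ∀ i, N i < s i)]
    refine and_congr_right fun _ => ⟨?_, fun h => ⟨v, mem_box.2 ⟨le_rfl, hvj⟩, h⟩⟩
    rintro ⟨M, hM, hMN⟩
    exact (mem_box.1 hM).1.trans hMN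
  rw [D]
  convert (congrArg Finset.card h).trans (Finset.card_finsupp _ _) using 1
  simp

theorem card_sdiff_prodSet {F : Type*} [DecidableEq F] {m : ℕ} {S T : Fin m → Finset F}
    {w : Fin m →₀ ℕ} (hT : ∀ i, T i ⊆ S i ∧ (T i).card = (S i).card - w i) :
    (Finset.univ \ prodSet S T).card = (∏ i, (S i).card) - ∏ i, ((S i).card - w i) := by
  rw [Finset.card_sdiff_of_subset (Finset.subset_univ _), Finset.card_univ, card_points,
    card_prodSet fun i => (hT i).1]
  simp only [(hT _).2]

theorem card_sdiff_eq {F : Type*} [DecidableEq F] {m : ℕ} {S T : Fin m → Finset F}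
    {w : Fin m →₀ ℕ} (hw : ∀ i, w i ≤ (S i).card)
    (hT : ∀ i, T i ⊆ S i ∧ (T i).card = (S i).card - w i) (i : Fin m) :
    (S i \ T i).card = w i := by
  rw [Finset.card_sdiff_of_subset (hT i).1, (hT i).2, Nat.sub_sub_self (hw i)]

theorem exists_subsets_card {F : Type*} {m : ℕ} {S : Fin m → Finset F} (w : Fin m →₀ ℕ) :
    ∃ T : Fin m → Finset F, ∀ i, T i ⊆ S i ∧ (T i).card = (S i).card - w i :=
  ⟨_, fun i => (Finset.exists_subset_card_eq (Nat.sub_le (S i).card (w i))).choose_spec⟩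

variable {F : Type*} [Field F] {m : ℕ}

/-! ### Supports, and words vanishing off a product -/

/-- The support of a nonzero polynomial with exponents at most `j`, evaluated on the Cartesian
product. -/
theorem card_support_ev [Fintype F] [DecidableEq F] {S : Fin m → Finset F} {j : Fin m →₀ ℕ}
    (hjs : ∀ i, j i < (S i).card) {f : MvPolynomial (Fin m) F} (hf : f.support ⊆ L₁ j)
    (h0 : ev S f ≠ 0) :
    ∏ i, ((S i).card - j i) ≤ (Finset.univ.filter fun p => ev S f p ≠ 0).card ∧
      ((Finset.univ.filter fun p => ev S f p ≠ 0).card = ∏ i, ((S i).card - j i) →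
        ∃ T : Fin m → Finset F, (∀ i, T i ⊆ S i ∧ (T i).card = (S i).card - j i) ∧
          (Finset.univ.filter fun p => ev S f p ≠ 0) = prodSet S T) := by
  set Z : Finset (Points S) := Finset.univ.filter fun p => ev S f p ≠ 0
  let X : Finset (Fin m → F) := Z.map (Function.Embedding.subtype _)
  have hX : ∀ x, x ∈ X ↔ (∀ i, x i ∈ S i) ∧ eval x f ≠ 0 := by
    intro x
    simp only [X, Z, Finset.mem_map, Finset.mem_filter, Finset.mem_univ, true_and, ev_apply]
    constructor
    · rintro ⟨p, hp, rfl⟩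
      exact ⟨Fintype.mem_piFinset.1 p.2, hp⟩
    · rintro ⟨h, hx⟩
      exact ⟨⟨x, Fintype.mem_piFinset.2 h⟩, hx, rfl⟩
  have hne : X.Nonempty := by
    obtain ⟨p, hp⟩ := Function.ne_iff.1 h0
    exact ⟨p.1, Finset.mem_map_of_mem _ (Finset.mem_filter.2 ⟨Finset.mem_univ p, hp⟩)⟩
  -- On the line the polynomial is nonzero at `x i`, so it has at most `j i` roots, and all other
  -- points of `S i` are in the support.
  have hlines : ∀ x ∈ X, ∀ i,
      (S i).card - j i ≤ (Finset.univ.filter fun t => Function.update x i t ∈ X).card := by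
    intro x hx i
    obtain ⟨hxS, hxf⟩ := (hX x).1 hx
    obtain ⟨p, hpdeg, hp⟩ := exists_polynomial_line f x i
    have hdeg : f.degreeOf i ≤ j i :=
      degreeOf_le_iff.2 fun M hM => mem_L₁.1 (hf hM) i
    have hp0 : p ≠ 0 := by
      rintro rfl
      have := hp (x i)
      rw [Function.update_eq_self, Polynomial.eval_zero] at this
      exact hxf this.symm
    have hroots : p.roots.toFinset.card ≤ j i :=
      (Multiset.toFinset_card_le _).trans ((p.card_roots').trans (hpdeg.trans hdeg))
    calc (S i).card - j i ≤ (S i).card - p.roots.toFinset.card := Nat.sub_le_sub_left hroots _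
      _ ≤ (S i \ p.roots.toFinset).card := Finset.le_card_sdiff _ _
      _ ≤ _ := Finset.card_le_card fun t ht => ?_
    obtain ⟨htS, htp⟩ := Finset.mem_sdiff.1 ht
    refine Finset.mem_filter.2 ⟨Finset.mem_univ _, (hX _).2 ⟨fun k => ?_, ?_⟩⟩
    · rcases eq_or_ne k i with rfl | hk
      · rwa [Function.update_self]
      · rw [Function.update_of_ne hk]
        exact hxS k
    · rw [← hp]
      intro h
      exact htp (Multiset.mem_toFinset.2 ((Polynomial.mem_roots hp0).2 h))
  have key := prod_le_card_of_lines X (fun i => (S i).card - j i)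
    (fun i => Nat.sub_pos_of_lt (hjs i)) hne hlines
  rw [show X.card = Z.card from Finset.card_map _] at key
  refine ⟨key.1, fun h => ?_⟩
  obtain ⟨T, hT, hXT⟩ := key.2 h
  refine ⟨T, fun i => ⟨fun t ht => ?_, hT i⟩, ?_⟩
  · obtain ⟨x, hx⟩ := hne
    have hxt : Function.update x i t ∈ X := by
      rw [hXT, Fintype.mem_piFinset] at hx ⊢
      intro k
      rcases eq_or_ne k i with rfl | hk
      · rwa [Function.update_self]
      · rw [Function.update_of_ne hk]
        exact hx k
    simpa using ((hX _).1 hxt).1 i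
  · ext p
    have : p ∈ Z ↔ p.1 ∈ X := (Finset.mem_map' (Function.Embedding.subtype _)).symm
    rw [this, hXT, Fintype.mem_piFinset]
    simp [prodSet]

/-- The product of linear factors contains `X^j`, a box monomial, with coefficient `1`; injectivity
of evaluation keeps it out of `C(L₂)`. -/
theorem exists_ev_eq_zero_of_card [DecidableEq F] {S T : Fin m → Finset F} {v j : Fin m →₀ ℕ}
    (hvj : v ≤ j) (hjs : ∀ i, j i < (S i).card) (hT : ∀ i, (S i \ T i).card = j i) :
    ∃ c ∈ code S (L₁ j), c ∉ code S (L₂ v j) ∧ ∀ p ∈ Finset.univ \ prodSet S T, c p = 0 := by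
  have hsupp : (vanishing S T).support ⊆ L₁ j := fun M hM =>
    mem_L₁.2 (le_of_mem_support_vanishing hT hM)
  refine ⟨_, mem_code.2 ⟨_, hsupp, rfl⟩, fun h => ?_, fun p hp => ?_⟩
  · obtain ⟨g, hg, hgv⟩ := mem_code.1 h
    have hgv' := eq_of_ev_eq ((hg.trans L₂_subset_L₁).trans (L₁_subset_delta hjs))
      (hsupp.trans (L₁_subset_delta hjs)) hgv
    have hj : j ∈ g.support := by
      rw [mem_support_iff, hgv', coeff_vanishing hT]
      exact one_ne_zero
    exact (mem_L₂.1 (hg hj)).2 (mem_box.2 ⟨hvj, le_rfl⟩)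
  · simpa using ev_mul_vanishing 1 hp

/-- Outside a product of sets of size `sᵢ - vᵢ`, every codeword of `C(L₁)` agrees with a codeword
of `C(L₂)`. -/
theorem exists_sub_mem_code [DecidableEq F] {S T : Fin m → Finset F} {v j : Fin m →₀ ℕ}
    (hT : ∀ i, (S i \ T i).card = v i) {c : Points S → F} (hc : c ∈ code S (L₁ j)) :
    ∃ c' ∈ code S (L₁ j), c - c' ∈ code S (L₂ v j) ∧
      ∀ p ∈ Finset.univ \ prodSet S T, c' p = 0 := by
  let U : Submodule F (Points S → F) := code S (L₁ j) ⊓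
    Submodule.pi (↑(Finset.univ \ prodSet S T) : Set (Points S)) fun _ => ⊥
  -- Induction on divisibility. For `M = v + e` in the box, `X^e` times the product of linear
  -- factors lies in `U` and equals `X^M` plus terms in proper divisors of `X^M`.
  have hmon : ∀ M, M ≤ j → ev S (monomial M 1) ∈ code S (L₂ v j) ⊔ U := by
    intro M
    induction M using WellFoundedLT.induction with
    | ind M ih =>
    intro hMj
    by_cases hM : M ∈ box v j
    · obtain ⟨e, rfl⟩ := exists_add_of_le (mem_box.1 hM).1
      set h : MvPolynomial (Fin m) F := monomial e 1 * vanishing S T with hh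
      have hle : ∀ N ∈ h.support, N ≤ v + e := by
        intro N hN
        rw [mem_support_iff, hh, coeff_monomial_mul'] at hN
        split_ifs at hN with heN
        · rw [one_mul] at hN
          have := le_of_mem_support_vanishing hT (mem_support_iff.2 hN)
          exact tsub_le_iff_right.1 this
        · exact absurd rfl hN
      have hcoeff : h.coeff (v + e) = 1 := by
        rw [hh, add_comm, coeff_monomial_mul, coeff_vanishing hT, one_mul]
      have hmem : v + e ∈ h.support := by
        rw [mem_support_iff, hcoeff]
        exact one_ne_zero
      have hU : ev S h ∈ U := by
        refine ⟨mem_code.2 ⟨h, fun N hN => mem_L₁.2 ((hle N hN).trans hMj), rfl⟩, ?_⟩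
        intro p hp
        exact ev_mul_vanishing _ (Finset.mem_coe.1 hp)
      have hsum : monomial (v + e) 1 =
          h - ∑ N ∈ h.support.erase (v + e), h.coeff N • monomial N (1 : F) := by
        rw [eq_sub_iff_add_eq]
        conv_rhs => rw [h.as_sum, ← Finset.add_sum_erase _ _ hmem, hcoeff]
        simp only [smul_monomial, smul_eq_mul, mul_one]
      rw [hsum, map_sub, map_sum]
      refine Submodule.sub_mem _ (Submodule.mem_sup_right hU) (Submodule.sum_mem _ fun N hN => ?_)
      obtain ⟨hne, hN⟩ := Finset.mem_erase.1 hN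
      rw [map_smul]
      exact Submodule.smul_mem _ _
        (ih N (lt_of_le_of_ne (hle N hN) hne) ((hle N hN).trans hMj))
    · refine Submodule.mem_sup_left (mem_code.2 ⟨_, fun N hN => ?_, rfl⟩)
      rw [Finset.mem_singleton.1 (support_monomial_subset hN)]
      exact mem_L₂.2 ⟨hMj, hM⟩
  have hle : code S (L₁ j) ≤ code S (L₂ v j) ⊔ U := by
    rw [code, Submodule.map_span, Submodule.span_le]
    rintro _ ⟨_, ⟨M, hM, rfl⟩, rfl⟩
    exact hmon M (mem_L₁.1 hM)
  obtain ⟨c₂, hc₂, u, hu, rfl⟩ := Submodule.mem_sup.1 (hle hc)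
  refine ⟨u, hu.1, by simpa using hc₂, fun p hp => ?_⟩
  simpa using hu.2 p (Finset.mem_coe.2 hp)

/-! ### The bound from considerateness -/

/-- If the scheme is considerate, the codewords of `C(L₁)` vanishing on a too large set do not
represent all classes modulo `C(L₂)`. -/
theorem card_add_prod_le_of_considerate [Fintype F] {S : Fin m → Finset F} {v j : Fin m →₀ ℕ}
    (hvj : v ≤ j) (hjs : ∀ i, j i < (S i).card)
    (hcons : Considerate (fun i => (S i).card) v j) {A : Finset (Points S)}
    (hA : ∀ c ∈ code S (L₁ j), ∃ c' ∈ code S (L₁ j), c - c' ∈ code S (L₂ v j) ∧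
      ∀ p ∈ A, c' p = 0) :
    A.card + ∏ i, ((S i).card - v i) ≤ ∏ i, (S i).card := by
  classical
  have hL₁ := L₁_subset_delta hjs
  -- Words of `C(L₂)` involve no box monomials, so a representative of the class of `X^β` has the
  -- box coefficients of `X^β`.
  have hrep : ∀ β : box v j, ∃ f : MvPolynomial (Fin m) F, f.support ⊆ L₁ j ∧
      (∀ p ∈ A, ev S f p = 0) ∧ ∀ γ ∈ box v j, f.coeff γ = if β.1 = γ then 1 else 0 := by
    intro β
    have hβ : (monomial β.1 (1 : F)).support ⊆ L₁ j := fun N hN => by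
      rw [Finset.mem_singleton.1 (support_monomial_subset hN)]
      exact mem_L₁.2 (mem_box.1 β.2).2
    obtain ⟨c', hc', h2, h3⟩ := hA _ (mem_code.2 ⟨_, hβ, rfl⟩)
    obtain ⟨f, hf, rfl⟩ := mem_code.1 hc'
    obtain ⟨g, hg, hgf⟩ := mem_code.1 h2
    rw [← map_sub] at hgf
    have hgf' := eq_of_ev_eq ((hg.trans L₂_subset_L₁).trans hL₁)
      (((support_sub _ _ _).trans (Finset.union_subset hβ hf)).trans hL₁) hgf
    refine ⟨f, hf, h3, fun γ hγ => ?_⟩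
    have hg0 : g.coeff γ = 0 := by
      by_contra h
      exact (mem_L₂.1 (hg (mem_support_iff.2 h))).2 hγ
    rw [hgf', coeff_sub, coeff_monomial, sub_eq_zero] at hg0
    exact hg0.symm
  choose f hfL hfA hfc using hrep
  let Φ : (box v j → F) →ₗ[F] MvPolynomial (Fin m) F := Fintype.linearCombination F f
  have hΦ : ∀ c, Φ c = ∑ β, c β • f β := fun c => Fintype.linearCombination_apply F f c
  have hΦc : ∀ c (γ : box v j), (Φ c).coeff γ.1 = c γ := by
    intro c γ
    rw [hΦ, coeff_sum]
    simp only [coeff_smul, hfc _ γ.1 γ.2, smul_eq_mul, mul_ite, mul_one, mul_zero]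
    simp only [Subtype.ext_iff.symm, Finset.sum_ite_eq', Finset.mem_univ, if_true]
  have hΦL : ∀ c, (Φ c).support ⊆ L₁ j := by
    intro c M hM
    by_contra hMj
    refine mem_support_iff.1 hM ?_
    rw [hΦ, coeff_sum]
    refine Finset.sum_eq_zero fun β _ => ?_
    rw [coeff_smul, notMem_support_iff.1 fun h => hMj (hfL β h), smul_zero]
  have hΦA : ∀ c, ∀ p ∈ A, ev S (Φ c) p = 0 := by
    intro c p hp
    rw [hΦ, map_sum, Finset.sum_apply]
    refine Finset.sum_eq_zero fun β _ => ?_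
    rw [map_smul, Pi.smul_apply, hfA β p hp, smul_zero]
  have hΦ0 : ∀ c, c ≠ 0 → Φ c ≠ 0 := by
    intro c hc h
    refine hc (funext fun γ => ?_)
    rw [← hΦc c γ, h, coeff_zero, Pi.zero_apply]
  -- Some box monomial `γ` occurs in `Φ c`, and the leading monomial is lexicographically at least
  -- `γ`, hence at least `v`.
  have hdeg : ∀ c, c ≠ 0 → MonomialOrder.lex.degree (Φ c) ∈ diamond v j := by
    intro c hc
    obtain ⟨γ, hγ⟩ := Function.ne_iff.1 hc
    have hγs : γ.1 ∈ (Φ c).support := by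
      rw [mem_support_iff, hΦc]
      exact hγ
    refine Finset.mem_filter.2 ⟨hΦL c (MonomialOrder.degree_mem_support (hΦ0 c hc)), ?_⟩
    exact (MonomialOrder.lex.toSyn_monotone (mem_box.1 γ.2).1).trans
      (MonomialOrder.le_degree hγs)
  let K : Finset (Fin m →₀ ℕ) :=
    (diamond v j).filter fun M => ∃ c, c ≠ 0 ∧ MonomialOrder.lex.degree (Φ c) = M
  have hKcard : (box v j).card ≤ K.card := by
    -- Reading coefficients at `K` is injective: a nonzero `Φ c` has a nonzero coefficient at its
    -- own leading monomial.
    let Ψ : (box v j → F) →ₗ[F] (K → F) := LinearMap.pi fun M => (lcoeff F M.1).comp Φ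
    have hΨ : Function.Injective Ψ := by
      rw [injective_iff_map_eq_zero]
      intro c hc
      by_contra h0
      have := congrFun hc ⟨_, Finset.mem_filter.2 ⟨hdeg c h0, c, h0, rfl⟩⟩
      exact MonomialOrder.coeff_degree_ne_zero_iff.2 (hΦ0 c h0) this
    simpa using LinearMap.finrank_le_finrank_of_injective hΨ
  obtain ⟨K₀, hK₀, hK₀card⟩ := Finset.exists_subset_card_eq hKcard
  have hpos : 1 ≤ (box v j).card := Finset.card_pos.2 ⟨v, mem_box.2 ⟨le_rfl, hvj⟩⟩
  obtain ⟨K', hK', hK'card, hmin⟩ := hcons _ hpos le_rfl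
  have hK'box : K' = box v j := Finset.eq_of_subset_of_card_le hK' hK'card.ge
  have hD := hmin K₀ (hK₀.trans (Finset.filter_subset _ _)) hK₀card
  rw [hK'box, D_box hvj] at hD
  refine (Nat.add_le_add_left hD _).trans
    (card_add_D_le S A {g | ∃ c, c ≠ 0 ∧ Φ c = g} ?_ ?_ K₀ ?_)
  · rintro _ ⟨c, hc, rfl⟩
    exact hΦ0 c hc
  · rintro _ ⟨c, -, rfl⟩
    exact hΦA c
  · intro M hM
    obtain ⟨-, c, hc, hM⟩ := Finset.mem_filter.1 (hK₀ hM)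
    exact ⟨_, ⟨c, hc, rfl⟩, hM⟩

end MonomialCartesian

/-! ### The theorem -/

open MonomialCartesian

theorem mainTheorem2 {F : Type*} [Field F] [Fintype F] [DecidableEq F] {m : ℕ}
    (S : Fin m → Finset F) (v j : Fin m →₀ ℕ)
    (hvj : ∀ i, v i < j i) (hjs : ∀ i, j i < (S i).card)
    (hcons : MonomialCartesian.Considerate (fun i => (S i).card) v j)
    {k₂ ℓ : ℕ}
    (σ : RampScheme (MonomialCartesian.code S (MonomialCartesian.L₂ v j))
      (MonomialCartesian.code S (MonomialCartesian.L₁ j)) k₂ ℓ) :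
    ℓ = (MonomialCartesian.box v j).card ∧
    σ.IsReconstructionNumber 1
      ((∏ i, (S i).card) - (∏ i, ((S i).card - v i)) + 1) ∧
    σ.IsReconstructionNumber ℓ
      ((∏ i, (S i).card) - (∏ i, ((S i).card - j i)) + 1) ∧
    (∀ T : Fin m → Finset F,
      (∀ i, T i ⊆ S i ∧ (T i).card = (S i).card - v i) →
        σ.MaximumNonQualifying 1 (Finset.univ \ MonomialCartesian.prodSet S T)) ∧
    (∀ A : Finset (MonomialCartesian.Points S),
      σ.MaximumNonQualifying ℓ A ↔
        ∃ T : Fin m → Finset F,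
          (∀ i, T i ⊆ S i ∧ (T i).card = (S i).card - j i) ∧
          A = Finset.univ \ MonomialCartesian.prodSet S T) := by
  have hle : v ≤ j := fun i => (hvj i).le
  have hL₁ := L₁_subset_delta hjs
  have hbox : box v j ⊆ L₁ j := fun M hM => mem_L₁.2 (mem_box.1 hM).2
  have hℓ : ℓ = (box v j).card := by
    have h1 := σ.finrank_left
    have h2 := σ.finrank_right
    rw [finrank_code (L₂_subset_L₁.trans hL₁), L₂, Finset.card_sdiff_of_subset hbox] at h1
    rw [finrank_code hL₁] at h2
    have := Finset.card_le_card hbox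
    omega
  have hmax1 : ∀ T : Fin m → Finset F,
      (∀ i, T i ⊆ S i ∧ (T i).card = (S i).card - v i) →
        σ.MaximumNonQualifying 1 (Finset.univ \ prodSet S T) := by
    intro T hT
    refine ⟨RampScheme.nonQualifying_one_iff.2 fun c hc =>
      exists_sub_mem_code (card_sdiff_eq (fun i => ((hvj i).trans (hjs i)).le) hT) hc,
      fun B hB => ?_⟩
    rw [card_sdiff_prodSet hT]
    have := card_add_prod_le_of_considerate hle hjs hcons
      (RampScheme.nonQualifying_one_iff.1 hB)
    omega
  have hbound : ∀ B : Finset (Points S), σ.NonQualifying ℓ B →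
      B.card ≤ (∏ i, (S i).card) - ∏ i, ((S i).card - j i) ∧
      (B.card = (∏ i, (S i).card) - ∏ i, ((S i).card - j i) → ∃ T : Fin m → Finset F,
          (∀ i, T i ⊆ S i ∧ (T i).card = (S i).card - j i) ∧
          B = Finset.univ \ prodSet S T) := by
    intro B hB
    obtain ⟨c, hc, hc₂, hcB⟩ := RampScheme.nonQualifying_codim_iff.1 hB
    obtain ⟨f, hf, rfl⟩ := mem_code.1 hc
    have key := card_support_ev hjs hf fun h => hc₂ (h ▸ Submodule.zero_mem _)
    set Z := Finset.univ.filter fun p => ev S f p ≠ 0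
    have hBZ : B ⊆ Finset.univ \ Z := fun p hp => by simp [Z, hcB p hp]
    have hZcard : (Finset.univ \ Z).card = (∏ i, (S i).card) - Z.card := by
      rw [Finset.card_sdiff_of_subset (Finset.subset_univ _), Finset.card_univ, card_points]
    have hcard := hZcard ▸ Finset.card_le_card hBZ
    refine ⟨hcard.trans (Nat.sub_le_sub_left key.1 _), fun h => ?_⟩
    -- Without this the truncated subtraction would not let equal differences force equal sizes.
    have hZle : Z.card ≤ ∏ i, (S i).card := card_points S ▸ Finset.card_le_univ Z
    have hZ : Z.card = ∏ i, ((S i).card - j i) := by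
      have := key.1
      omega
    obtain ⟨T, hT, hZT⟩ := key.2 hZ
    refine ⟨T, hT, ?_⟩
    rw [← hZT]
    exact Finset.eq_of_subset_of_card_le hBZ (by rw [hZcard, hZ, h])
  have hmaxℓ : ∀ T : Fin m → Finset F,
      (∀ i, T i ⊆ S i ∧ (T i).card = (S i).card - j i) →
        σ.MaximumNonQualifying ℓ (Finset.univ \ prodSet S T) := by
    intro T hT
    refine ⟨RampScheme.nonQualifying_codim_iff.2
      (exists_ev_eq_zero_of_card hle hjs (card_sdiff_eq (fun i => (hjs i).le) hT)),
      fun B hB => ?_⟩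
    rw [card_sdiff_prodSet hT]
    exact (hbound B hB).1
  obtain ⟨T₁, hT₁⟩ := exists_subsets_card (S := S) v
  obtain ⟨T₂, hT₂⟩ := exists_subsets_card (S := S) j
  refine ⟨hℓ, ?_, ?_, hmax1, fun A => ⟨fun hA => ?_, ?_⟩⟩
  · rw [← card_sdiff_prodSet hT₁]
    exact RampScheme.isReconstructionNumber_of_maximumNonQualifying (hmax1 T₁ hT₁)
  · rw [← card_sdiff_prodSet hT₂]
    exact RampScheme.isReconstructionNumber_of_maximumNonQualifying (hmaxℓ T₂ hT₂)
  · refine (hbound A hA.1).2 (le_antisymm (hbound A hA.1).1 ?_)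
    rw [← card_sdiff_prodSet hT₂]
    exact hA.2 _ (hmaxℓ T₂ hT₂).1
  · rintro ⟨T, hT, rfl⟩
    exact hmaxℓ T hT
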